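/- Let $s\ge 6$ and $d\ge 1$ be integers. Let $a_1=0,a_2,\dots,a_s$ be pairwise distinct integers such that the greatest common divisor of the nonzero ones is $1$, and let $\mathcal B_1,\dots,\mathcal B_s$ be nonempty subsets of $\mathbb Z/d\mathbb Z$ with $0\in\mathcal B_1$. Put $$\tilde{\mathcal B}=\bigcup_{i=1}^s \{a_i\}\times\mathcal B_i\subset \mathbb Z\times\mathbb Z/d\mathbb Z ,\qquad \tilde{\mathcal B}+\tilde{\mathcal B}=\{u+v: u,v\in\tilde{\mathcal B}\},$$ and suppose that $|\tilde{\mathcal B}+\tilde{\mathcal B}|<2.5\,|\tilde{\mathcal B}|$. Then $\max_i a_i<1.5\,s$, and there exist a subgroup $\tilde{\mathcal H}$ of $\mathbb Z/d\mathbb Z$ and elements $x,y\in\mathbb Z/d\mathbb Z$ such that $\mathcal B_i\subset a_ix+y+\tilde{\mathcal H}$ for every $i$. Further, for this same subgroup, $|\mathcal B_j|\ge\frac23|\tilde{\mathcal H}|$ for some $j$ with $1\le j\le s$, and $$\bigl(\max_i a_i\bigr)\,|\tilde{\mathcal H}|\le|\tilde{\mathcal B}+\tilde{\mathcal B}|-|\tilde{\mathcal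 B}| .$$ -/

import Mathlib

open scoped Pointwise

/-- The set `⋃ i, {a i} × B i` in `ℤ × ℤ/dℤ`. -/
def fiberUnion {s d : ℕ} (a : Fin s → ℤ) (B : Fin s → Finset (ZMod d)) :
    Finset (ℤ × ZMod d) :=
  Finset.univ.biUnion fun i => {a i} ×ˢ B i

/-! Translate the set so that its lowest level is `0`, let `L` be its top level, and pick a point `g
= (L, b)` of it there. Reduce modulo `g` and apply Kneser's theorem to the image; it yields a finite
period group `S`, and `ρ` is reduction modulo `g` and then `S`. If `B` meets `k` classes of `ρ`,
then `B + B` has at least `(2k - 1)|S|` elements modulo `g`. Lifting back adds at least `|B|`, since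
`z` and `z + g` both lie in `B + B` for every `z ∈ B` (`card_image_add_sum_max_le`).

With doubling below `5/2` and six levels this leaves `k ≤ 4`. The values `2, 3, 4` are excluded by
applying Kneser again to pairs of classes, or by counting the levels that different classes can
occupy (`card_image_le_one`). So `k = 1` and `B` lies in `K = ker ρ`. The gcd condition puts some
`(1, x)` in `K`, which straightens the fibres into cosets of `H = K ∩ ({0} × G)` and gives `|S| ≥
L|H|`; hence `L|H| + |B| ≤ |B + B|`, and the bound on the maximum follows from `|B| ≤ s|H|`.

If every fibre were below `2/3` of `H`, this inequality would force the levels to fill `[0, L]` with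
total deficit so small that pigeonhole makes all but the three extreme levels at each end of `B + B`
large, contradicting the doubling (`small_fibers_false`). -/

/-! ### Kneser's theorem, by Dyson transforms and unions of periodic sets. -/

section Kneser

open Finset

variable {G : Type*} [AddCommGroup G]

/-- A subgroup of translations preserving a nonempty finite set is finite. -/
lemma finite_of_add_mem {C : Finset G} {S : AddSubgroup G} (hC : C.Nonempty)
    (h : ∀ x ∈ C, ∀ s ∈ S, x + s ∈ C) : Finite S := by
  obtain ⟨x, hx⟩ := hC
  exact Finite.of_injective (fun s : S => (⟨x + s, h x hx s s.2⟩ : C)) fun a b hab => by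
    simpa using hab

/-- The elements of a finite subgroup as a `Finset`. -/
lemma exists_finset_of_finite (S : AddSubgroup G) [Finite S] :
    ∃ F : Finset G, (∀ x, x ∈ F ↔ x ∈ S) ∧ #F = Nat.card S := by
  have hS : (S : Set G).Finite := Set.toFinite _
  exact ⟨hS.toFinset, by simp, by rw [← Set.ncard_eq_toFinset_card _ hS]; rfl⟩

lemma card_le_card_of_sub_mem {X : Finset G} {S : AddSubgroup G} [Finite S] (c : G)
    (h : ∀ x ∈ X, x - c ∈ S) : #X ≤ Nat.card S := by
  classical
  obtain ⟨F, hF, hc⟩ := exists_finset_of_finite S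
  rw [← hc]
  exact card_le_card_of_injOn (· - c) (fun x hx => by simpa [hF] using h x hx)
    fun a _ b _ hab => by simpa using hab

/-- A union of cosets of `S` has `|S|` times as many elements as its image modulo `S`. -/
lemma card_eq_card_image_mk_mul {X : Finset G} {S : AddSubgroup G} [Finite S]
    [DecidableEq (G ⧸ S)] (h : ∀ x ∈ X, ∀ s ∈ S, x + s ∈ X) :
    #X = #(X.image (QuotientAddGroup.mk' S)) * Nat.card S := by
  classical
  obtain ⟨F, hF, hc⟩ := exists_finset_of_finite S
  rw [card_eq_sum_card_image (QuotientAddGroup.mk' S) X, sum_const_nat]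
  intro q hq
  obtain ⟨x, hx, rfl⟩ := mem_image.1 hq
  rw [← hc, ← card_image_of_injective F (add_right_injective x)]
  congr 1
  ext y
  rw [mem_filter, mem_image]
  simp only [QuotientAddGroup.mk'_apply, hF]
  constructor
  · rintro ⟨_, hy⟩
    exact ⟨-x + y, QuotientAddGroup.eq.1 hy.symm, by simp⟩
  · rintro ⟨s, hs, rfl⟩
    exact ⟨h x hx s hs, (QuotientAddGroup.eq.2 (by simpa using hs)).symm⟩

variable [DecidableEq G]

/-- Split each coset `x + Sᵢ` by membership in the other set. One part of each lies in `C₁ \ C₂`;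
the remaining parts, if both are nonempty, shift into `C₂ \ C₁` by an element of one another. In
either place the two parts overlap in at most a coset of `S₁ ⊓ S₂`. The last two alternatives are
the cases of an empty remainder. -/
lemma add_card_le_of_mem_sdiff {C₁ C₂ : Finset G} {S₁ S₂ : AddSubgroup G} [Finite S₁] [Finite S₂]
    (h₁ : ∀ x ∈ C₁, ∀ s ∈ S₁, x + s ∈ C₁) (h₂ : ∀ x ∈ C₂, ∀ s ∈ S₂, x + s ∈ C₂)
    {x : G} (hx₁ : x ∈ C₁) (hx₂ : x ∉ C₂) :
    Nat.card S₁ + Nat.card S₂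
        ≤ #(C₁ \ C₂) + #(C₂ \ C₁) + 2 * Nat.card (S₁ ⊓ S₂ : AddSubgroup G) ∨
      Nat.card S₁ ≤ #(C₁ \ C₂) ∨ Nat.card S₂ ≤ #(C₁ \ C₂) := by
  obtain ⟨F₁, hF₁, hc₁⟩ := exists_finset_of_finite S₁
  obtain ⟨F₂, hF₂, hc₂⟩ := exists_finset_of_finite S₂
  have hfin : Finite (S₁ ⊓ S₂ : AddSubgroup G) :=
    Finite.of_injective (AddSubgroup.inclusion (inf_le_left : S₁ ⊓ S₂ ≤ S₁))
      (AddSubgroup.inclusion_injective _)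
  have h₁' : ∀ y, ∀ s ∈ S₁, y + s ∈ C₁ → y ∈ C₁ := fun y s hs hy => by
    simpa using h₁ _ hy (-s) (neg_mem hs)
  have h₂' : ∀ y, ∀ s ∈ S₂, y + s ∈ C₂ → y ∈ C₂ := fun y s hs hy => by
    simpa using h₂ _ hy (-s) (neg_mem hs)
  set R := F₁.filter fun r => x + r ∉ C₂ with hR
  set T := F₂.filter fun t => x + t ∈ C₁ with hT
  have hRT : #(R ∪ T) ≤ #(C₁ \ C₂) := by
    refine card_le_card_of_injOn (x + ·) ?_ fun a _ b _ hab => by simpa using hab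
    intro r hr
    simp only [hR, hT, coe_union, coe_filter, Set.mem_union, Set.mem_ofPred_eq, hF₁, hF₂] at hr
    simp only [coe_sdiff, Set.mem_sdiff, mem_coe]
    rcases hr with ⟨hr, hr'⟩ | ⟨hr, hr'⟩
    · exact ⟨h₁ _ hx₁ _ hr, hr'⟩
    · exact ⟨hr', fun h => hx₂ (h₂' _ _ hr h)⟩
  by_cases hR' : ∃ g ∈ F₁, x + g ∈ C₂
  swap
  · right; left
    push Not at hR'
    rw [← hc₁, ← filter_true_of_mem hR']
    exact (card_le_card subset_union_left).trans hRT
  by_cases hT' : ∃ g ∈ F₂, x + g ∉ C₁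
  swap
  · right; right
    push Not at hT'
    rw [← hc₂, ← filter_true_of_mem hT']
    exact (card_le_card subset_union_right).trans hRT
  left
  obtain ⟨g₁, hg₁, hg₁'⟩ := hR'
  obtain ⟨g₂, hg₂, hg₂'⟩ := hT'
  rw [hF₁] at hg₁
  rw [hF₂] at hg₂
  have hint : #(R ∩ T) ≤ Nat.card (S₁ ⊓ S₂ : AddSubgroup G) := by
    refine card_le_card_of_sub_mem 0 fun r hr => ?_
    simp only [hR, hT, mem_inter, mem_filter, hF₁, hF₂] at hr
    simpa using ⟨hr.1.1, hr.2.1⟩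
  set R' := F₁.filter fun r => ¬ x + r ∉ C₂ with hR'
  set T' := F₂.filter fun t => ¬ x + t ∈ C₁ with hT'
  have hcR : #R + #R' = #F₁ := card_filter_add_card_filter_not _
  have hcT : #T + #T' = #F₂ := card_filter_add_card_filter_not _
  set U := R'.image (· + g₂) with hU
  set V := T'.image (· + g₁) with hV
  have hcU : #U = #R' := card_image_of_injective _ (add_left_injective _)
  have hcV : #V = #T' := card_image_of_injective _ (add_left_injective _)
  have hUV : #(U ∪ V) ≤ #(C₂ \ C₁) := by
    refine card_le_card_of_injOn (x + ·) ?_ fun a _ b _ hab => by simpa using hab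
    intro r hr
    simp only [mem_coe, mem_union, hU, hV, mem_image, hR', hT', mem_filter, hF₁, hF₂, not_not] at hr
    simp only [coe_sdiff, Set.mem_sdiff, mem_coe]
    rcases hr with ⟨r, ⟨hr, hr'⟩, rfl⟩ | ⟨r, ⟨hr, hr'⟩, rfl⟩
    · refine ⟨by simpa [add_assoc] using h₂ _ hr' _ hg₂, fun h => hg₂' (h₁' _ r hr ?_)⟩
      convert h using 1; abel
    · refine ⟨by convert h₂ _ hg₁' _ hr using 1; abel, fun h => hr' (h₁' _ _ hg₁ ?_)⟩
      convert h using 1; abel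
  have hint' : #(U ∩ V) ≤ Nat.card (S₁ ⊓ S₂ : AddSubgroup G) := by
    refine card_le_card_of_sub_mem (g₁ + g₂) fun r hr => ?_
    simp only [mem_inter, hU, hV, mem_image, hR', hT', mem_filter, hF₁, hF₂, not_not] at hr
    obtain ⟨⟨a, ⟨ha, -⟩, rfl⟩, ⟨b, ⟨hb, -⟩, hab⟩⟩ := hr
    refine ⟨?_, ?_⟩
    · have : a + g₂ - (g₁ + g₂) = a - g₁ := by abel
      rw [this]; exact S₁.sub_mem ha hg₁
    · have : a + g₂ - (g₁ + g₂) = b - g₂ := by rw [← hab]; abel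
      rw [this]; exact S₂.sub_mem hb hg₂
  have e₁ := card_union_add_card_inter R T
  have e₂ := card_union_add_card_inter U V
  omega

/-- Sets `C` with `t ≤ |C| + |S|` for some group `S` of periods of `C` are closed under unions. -/
lemma exists_periods_union {C₁ C₂ : Finset G} {t : ℕ} (hC₁ : C₁.Nonempty) (hC₂ : C₂.Nonempty)
    (h₁ : ∃ S : AddSubgroup G, (∀ x ∈ C₁, ∀ s ∈ S, x + s ∈ C₁) ∧ t ≤ #C₁ + Nat.card S)
    (h₂ : ∃ S : AddSubgroup G, (∀ x ∈ C₂, ∀ s ∈ S, x + s ∈ C₂) ∧ t ≤ #C₂ + Nat.card S) :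
    ∃ S : AddSubgroup G, (∀ x ∈ C₁ ∪ C₂, ∀ s ∈ S, x + s ∈ C₁ ∪ C₂) ∧
      t ≤ #(C₁ ∪ C₂) + Nat.card S := by
  by_cases h12 : C₁ ⊆ C₂
  · rwa [union_eq_right.2 h12]
  by_cases h21 : C₂ ⊆ C₁
  · rwa [union_eq_left.2 h21]
  obtain ⟨S₁, hS₁, ht₁⟩ := h₁
  obtain ⟨S₂, hS₂, ht₂⟩ := h₂
  obtain ⟨x, hx₁, hx₂⟩ := not_subset.1 h12
  obtain ⟨y, hy₂, hy₁⟩ := not_subset.1 h21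
  have := finite_of_add_mem hC₁ hS₁
  have := finite_of_add_mem hC₂ hS₂
  refine ⟨S₁ ⊓ S₂, fun z hz s hs => ?_, ?_⟩
  · rcases mem_union.1 hz with hz | hz
    · exact mem_union_left _ (hS₁ z hz s hs.1)
    · exact mem_union_right _ (hS₂ z hz s hs.2)
  -- In the main alternative, averaging the two bounds on `t` suffices; in the others a period group
  -- is no larger than one of the two differences.
  have e₁ := add_card_le_of_mem_sdiff hS₁ hS₂ hx₁ hx₂
  have e₂ := add_card_le_of_mem_sdiff hS₂ hS₁ hy₂ hy₁
  rw [inf_comm] at e₂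
  have e₃ : #(C₁ ∪ C₂) = #C₁ + #(C₂ \ C₁) := by rw [← card_union_of_disjoint disjoint_sdiff]; simp
  have e₄ : #(C₁ ∪ C₂) = #C₂ + #(C₁ \ C₂) := by
    rw [← card_union_of_disjoint disjoint_sdiff, union_comm]; simp
  omega

/-- Through every element `a + b` of `A + B` passes a subset with many periods. -/
lemma exists_periods_subset_add (a b : G) (N : ℕ) : ∀ A B : Finset G, #B = N → a ∈ A → b ∈ B →
    ∃ C ⊆ A + B, a + b ∈ C ∧
      ∃ S : AddSubgroup G, (∀ x ∈ C, ∀ s ∈ S, x + s ∈ C) ∧ #A + #B ≤ #C + Nat.card S := by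
  induction N using Nat.strong_induction_on with
  | _ N ih =>
  intro A B hB ha hb
  -- Here `B - b` stabilizes `A`, so `C = A + b` works. Otherwise a Dyson transform at `e` moves
  -- elements from `B` to `A`, keeping `|A| + |B|` and the points `a`, `b`, and not enlarging `A +
  -- B`.
  by_cases h : ∀ e ∈ A, ∀ y ∈ B, e + (y - b) ∈ A
  · have hper : ∀ x ∈ A, ∀ s ∈ AddAction.stabilizer G A, x + s ∈ A := by
      intro x hx s hs
      rw [AddAction.mem_stabilizer_iff] at hs
      rw [← hs, add_comm]
      exact vadd_mem_vadd_finset hx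
    refine ⟨A.image (· + b), ?_, mem_image_of_mem _ ha, AddAction.stabilizer G A, ?_, ?_⟩
    · intro x hx
      obtain ⟨y, hy, rfl⟩ := mem_image.1 hx
      exact add_mem_add hy hb
    · intro x hx s hs
      obtain ⟨y, hy, rfl⟩ := mem_image.1 hx
      exact mem_image.2 ⟨y + s, hper y hy s hs, by abel⟩
    · have := finite_of_add_mem ⟨a, ha⟩ hper
      rw [card_image_of_injective _ (add_left_injective _)]
      refine Nat.add_le_add_left (card_le_card_of_sub_mem b fun y hy => ?_) _
      rw [AddAction.mem_stabilizer_iff]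
      refine eq_of_subset_of_card_le (fun z hz => ?_) (by simp)
      obtain ⟨e, he, rfl⟩ := mem_vadd_finset.1 hz
      rw [vadd_eq_add, add_comm]
      exact h e he y hy
  · push Not at h
    obtain ⟨e, he, y, hy, hey⟩ := h
    set B₁ := B.filter fun z => e + (z - b) ∈ A with hB₁
    set A₁ := A ∪ B.image (fun z => e + (z - b)) with hA₁
    have hinj : Function.Injective fun z => e + (z - b) := fun u v huv => by simpa using huv
    have hlt : #B₁ < N := by
      rw [← hB]
      refine card_lt_card ⟨filter_subset _ _, fun hs => hey ?_⟩
      exact (mem_filter.1 (hs hy)).2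
    have hcard : #A₁ + #B₁ = #A + #B := by
      have h1 := card_union_add_card_inter A (B.image fun z => e + (z - b))
      have h2 : #(A ∩ B.image fun z => e + (z - b)) = #B₁ := by
        rw [← card_image_of_injective B₁ hinj]
        congr 1
        ext z
        simp only [mem_inter, mem_image, hB₁, mem_filter]
        constructor
        · rintro ⟨hz, w, hw, rfl⟩; exact ⟨w, ⟨hw, hz⟩, rfl⟩
        · rintro ⟨w, ⟨hw, hz⟩, rfl⟩; exact ⟨hz, w, hw, rfl⟩
      rw [h2, card_image_of_injective _ hinj] at h1
      exact h1
    obtain ⟨C, hC, habC, S, hS, hle⟩ := ih _ hlt A₁ B₁ rfl (mem_union_left _ ha)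
      (mem_filter.2 ⟨hb, by simpa using he⟩)
    refine ⟨C, hC.trans fun z hz => ?_, habC, S, hS, hcard ▸ hle⟩
    obtain ⟨u, hu, v, hv, rfl⟩ := mem_add.1 hz
    obtain ⟨hv, hv'⟩ := mem_filter.1 hv
    rcases mem_union.1 hu with hu | hu
    · exact add_mem_add hu hv
    · obtain ⟨w, hw, rfl⟩ := mem_image.1 hu
      exact mem_add.2 ⟨_, hv', w, hw, by abel⟩

/-- **Kneser's theorem**, in the form `|A| + |B| ≤ |A + B| + |S|` for a group `S` of periods. -/
theorem kneser {A B : Finset G} (hA : A.Nonempty) (hB : B.Nonempty) :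
    ∃ S : AddSubgroup G, (∀ x ∈ A + B, ∀ s ∈ S, x + s ∈ A + B) ∧
      #A + #B ≤ #(A + B) + Nat.card S := by
  have key : ∀ c ∈ A + B, ∃ C ⊆ A + B, c ∈ C ∧
      ∃ S : AddSubgroup G, (∀ x ∈ C, ∀ s ∈ S, x + s ∈ C) ∧ #A + #B ≤ #C + Nat.card S := by
    intro c hc
    obtain ⟨a, ha, b, hb, rfl⟩ := mem_add.1 hc
    exact exists_periods_subset_add a b _ A B rfl ha hb
  suffices H : ∀ T : Finset G, T.Nonempty → T ⊆ A + B → ∃ C ⊆ A + B, T ⊆ C ∧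
      ∃ S : AddSubgroup G, (∀ x ∈ C, ∀ s ∈ S, x + s ∈ C) ∧ #A + #B ≤ #C + Nat.card S by
    obtain ⟨C, hC, hC', h⟩ := H (A + B) (hA.add hB) subset_rfl
    rwa [hC.antisymm hC'] at h
  intro T hT
  induction hT using Finset.Nonempty.cons_induction with
  | singleton c =>
    intro hc
    simpa using key c (by simpa using hc)
  | cons c T hcT hT ih =>
    intro hcT'
    rw [cons_eq_insert, insert_subset_iff] at hcT'
    obtain ⟨C₁, hC₁, hT₁, h₁⟩ := ih hcT'.2
    obtain ⟨C₂, hC₂, hT₂, h₂⟩ := key c hcT'.1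
    refine ⟨C₁ ∪ C₂, union_subset hC₁ hC₂, ?_,
      exists_periods_union (hT.mono hT₁) ⟨c, hT₂⟩ h₁ h₂⟩
    rw [cons_eq_insert, insert_subset_iff]
    exact ⟨mem_union_right _ hT₂, hT₁.trans subset_union_left⟩

/-- **Kneser's theorem** modulo the stabilizer of the sumset. -/
theorem kneser_quotient {A B : Finset G} (hA : A.Nonempty) (hB : B.Nonempty) :
    ∃ S : AddSubgroup G, Finite S ∧ (∀ x ∈ A + B, ∀ s ∈ S, x + s ∈ A + B) ∧
      ∀ _ : DecidableEq (G ⧸ S),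
        #(A.image (QuotientAddGroup.mk' S)) + #(B.image (QuotientAddGroup.mk' S))
          ≤ #((A + B).image (QuotientAddGroup.mk' S)) + 1 := by
  set S := AddAction.stabilizer G (A + B) with hS
  have hper : ∀ x ∈ A + B, ∀ s ∈ S, x + s ∈ A + B := by
    intro x hx s hs
    rw [hS, AddAction.mem_stabilizer_iff] at hs
    rw [← hs, add_comm x]
    exact vadd_mem_vadd_finset hx
  have hfin := finite_of_add_mem (hA.add hB) hper
  refine ⟨S, hfin, hper, fun _ => ?_⟩
  obtain ⟨F, hF, hc⟩ := exists_finset_of_finite S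
  have hF0 : F.Nonempty := ⟨0, (hF 0).2 (zero_mem _)⟩
  have hsat : ∀ X : Finset G, #(X + F) = #(X.image (QuotientAddGroup.mk' S)) * Nat.card S := by
    intro X
    rw [card_eq_card_image_mk_mul (S := S)]
    · congr 2
      ext q
      simp only [mem_image, mem_add]
      constructor
      · rintro ⟨_, ⟨x, hx, f, hf, rfl⟩, rfl⟩
        exact ⟨x, hx, QuotientAddGroup.eq.2 (by simpa using (hF f).1 hf)⟩
      · rintro ⟨x, hx, rfl⟩
        exact ⟨x, ⟨x, hx, 0, (hF 0).2 (zero_mem _), by simp⟩, rfl⟩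
    · intro x hx s hs
      obtain ⟨u, hu, f, hf, rfl⟩ := mem_add.1 hx
      exact mem_add.2 ⟨u, hu, f + s, (hF _).2 (add_mem ((hF f).1 hf) hs), by abel⟩
  have hsum : (A + F) + (B + F) = A + B := by
    ext z
    constructor
    · intro hz
      obtain ⟨u, hu, v, hv, rfl⟩ := mem_add.1 hz
      obtain ⟨a, ha, f, hf, rfl⟩ := mem_add.1 hu
      obtain ⟨b, hb, g, hg, rfl⟩ := mem_add.1 hv
      have := hper _ (add_mem_add ha hb) (f + g) (add_mem ((hF f).1 hf) ((hF g).1 hg))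
      convert this using 1; abel
    · intro hz
      obtain ⟨a, ha, b, hb, rfl⟩ := mem_add.1 hz
      have h0 := (hF 0).2 (zero_mem _)
      exact mem_add.2 ⟨a, mem_add.2 ⟨a, ha, 0, h0, by simp⟩, b, mem_add.2 ⟨b, hb, 0, h0, by simp⟩,
        rfl⟩
  -- Kneser is applied to the saturations `A + S` and `B + S`, whose sum is still `A + B`; all
  -- cardinalities are then multiples of `|S|`.
  obtain ⟨S', hS', hle⟩ := kneser (hA.add hF0) (hB.add hF0)
  rw [hsum] at hS' hle
  have hSS : Nat.card S' ≤ Nat.card S := by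
    refine Nat.card_le_card_of_injective (AddSubgroup.inclusion (K := S) fun s hs => ?_)
      (AddSubgroup.inclusion_injective _)
    rw [hS, AddAction.mem_stabilizer_iff]
    refine eq_of_subset_of_card_le (fun z hz => ?_) (by simp)
    obtain ⟨e, he, rfl⟩ := mem_vadd_finset.1 hz
    rw [vadd_eq_add, add_comm s]
    exact hS' e he s hs
  rw [hsat, hsat, card_eq_card_image_mk_mul hper, ← add_mul] at hle
  have hpos : 0 < Nat.card S := Nat.card_pos
  refine Nat.le_of_mul_le_mul_right (c := Nat.card S) ?_ hpos
  rw [add_mul _ 1, one_mul]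
  exact hle.trans (Nat.add_le_add_left hSS _)

end Kneser

/-! ### Lifting from the quotient, and sizes of classes of `ρ`. -/

section Fibers

open Finset

variable {G Γ : Type*} [AddCommGroup G] [AddCommGroup Γ] [DecidableEq G]

/-- The sumset `B + B` exceeds its image modulo `g = (L, b)` by at least
`∑ max |Bᵢ| |M|`, where `Bᵢ` are the fibres of `B` and `M` is the set of `z ∈ B` over `0` for which
`z + g ∈ B`. -/
lemma card_image_add_sum_max_le [DecidableEq Γ] {φ : ℤ × G →+ Γ} {B M : Finset (ℤ × G)} {L : ℤ} {b : G}
    (hL : 0 < L) (h0 : 0 ∈ B) (hg : (L, b) ∈ B) (hφ : φ (L, b) = 0)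
    (hM : ∀ z ∈ M, z ∈ B ∧ z.1 = 0 ∧ z + (L, b) ∈ B) :
    #((B + B).image φ) + ∑ i ∈ B.image Prod.fst, max #(B.filter fun z => z.1 = i) #M
      ≤ #(B + B) := by
  rw [← card_filter_add_card_filter_not (s := B + B) (fun z => z + (L, b) ∈ B + B), add_comm]
  refine add_le_add ?_ ?_
  · refine le_trans (sum_le_sum fun i hi => ?_)
      ((sum_card_fiberwise_eq_card_filter ((B + B).filter fun z => z + (L, b) ∈ B + B)
        (B.image Prod.fst) Prod.fst).trans_le (card_filter_le _ _))
    obtain ⟨w, hw, rfl⟩ := mem_image.1 hi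
    refine max_le (card_le_card fun z hz => ?_) ?_
    · obtain ⟨hz, hzw⟩ := mem_filter.1 hz
      refine mem_filter.2 ⟨mem_filter.2 ⟨?_, add_mem_add hz hg⟩, hzw⟩
      simpa using add_mem_add hz h0
    · refine card_le_card_of_injOn (· + w) (fun z hz => ?_) fun u _ v _ huv => by simpa using huv
      obtain ⟨hz, hz0, hzg⟩ := hM z hz
      refine mem_coe.2 (mem_filter.2 ⟨mem_filter.2 ⟨add_mem_add hz hw, ?_⟩, by simp [hz0]⟩)
      rw [add_right_comm]
      exact add_mem_add hzg hw
  · refine (card_le_card fun q hq => ?_).trans (card_image_le (f := φ))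
    obtain ⟨z, hz, rfl⟩ := mem_image.1 hq
    -- The highest element of a class cannot be raised by `g` inside `B + B`, so the elements that
    -- cannot be raised represent every class.
    obtain ⟨t, ht, hmax⟩ := exists_max_image ((B + B).filter fun w => φ w = φ z) Prod.fst
      ⟨z, mem_filter.2 ⟨hz, rfl⟩⟩
    obtain ⟨ht, htz⟩ := mem_filter.1 ht
    refine mem_image.2 ⟨t, mem_filter.2 ⟨ht, fun htg => ?_⟩, htz⟩
    have := hmax _ (mem_filter.2 ⟨htg, by rw [map_add, hφ, add_zero, htz]⟩)
    simp only [Prod.fst_add] at this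
    omega

lemma card_le_card_ker_inr [Finite G] {ρ : ℤ × G →+ Γ} {X : Finset (ℤ × G)} {i : ℤ} {c : Γ}
    (h₁ : ∀ z ∈ X, z.1 = i) (h₂ : ∀ z ∈ X, ρ z = c) :
    #X ≤ Nat.card (ρ.comp (AddMonoidHom.inr ℤ G)).ker := by
  rcases X.eq_empty_or_nonempty with rfl | ⟨w, hw⟩
  · simp
  have hinj : Set.InjOn Prod.snd (X : Set (ℤ × G)) := fun u hu v hv huv =>
    Prod.ext ((h₁ u hu).trans (h₁ v hv).symm) huv
  rw [← card_image_of_injOn hinj]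
  refine card_le_card_of_sub_mem w.2 fun y hy => ?_
  obtain ⟨z, hz, rfl⟩ := mem_image.1 hy
  have : (AddMonoidHom.inr ℤ G) (z.2 - w.2) = z - w := by
    ext <;> simp [h₁ z hz, h₁ w hw]
  rw [AddMonoidHom.mem_ker, AddMonoidHom.comp_apply, this, map_sub, h₂ z hz, h₂ w hw, sub_self]

/-- If the classes of `ρ` have at most `q` elements over `[0, L)`, then a set `N` of integers in
`[0, L)` met by a single class has `|N| |H| ≤ q`, where `H` is the kernel of `ρ` on `{0} × G`. -/
lemma card_mul_card_ker_le [Finite G] {ρ : ℤ × G →+ Γ} {L : ℤ} {q : ℕ}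
    (hbox : ∀ X : Finset (ℤ × G), (∀ z ∈ X, 0 ≤ z.1 ∧ z.1 < L) →
      (∀ z ∈ X, ∀ w ∈ X, ρ z = ρ w) → #X ≤ q)
    {N : Finset ℤ} {c : Γ} (hN : ∀ i ∈ N, 0 ≤ i ∧ i < L) (hc : ∀ i ∈ N, ∃ x, ρ (i, x) = c) :
    #N * Nat.card (ρ.comp (AddMonoidHom.inr ℤ G)).ker ≤ q := by
  obtain ⟨F, hF, hcard⟩ := exists_finset_of_finite (ρ.comp (AddMonoidHom.inr ℤ G)).ker
  choose! f hf using hc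
  rw [← hcard, ← card_product]
  have hinj : Set.InjOn (fun p : ℤ × G => (p.1, f p.1 + p.2)) (N ×ˢ F : Finset (ℤ × G)) := by
    rintro ⟨i, x⟩ _ ⟨j, y⟩ _ h
    simp only [Prod.mk.injEq] at h
    obtain ⟨rfl, h⟩ := h
    simpa using h
  have hρ : ∀ p ∈ N ×ˢ F, ρ (p.1, f p.1 + p.2) = c := by
    rintro ⟨i, x⟩ hp
    rw [mem_product, hF] at hp
    have h1 : ((i, f i + x) : ℤ × G) = (i, f i) + AddMonoidHom.inr ℤ G x := by simp
    have h2 : ρ (AddMonoidHom.inr ℤ G x) = 0 := hp.2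
    rw [h1, map_add, hf i hp.1, h2, add_zero]
  rw [← card_image_of_injOn hinj]
  refine hbox _ (fun z hz => ?_) fun z hz w hw => ?_
  · obtain ⟨p, hp, rfl⟩ := mem_image.1 hz
    exact hN _ (mem_product.1 hp).1
  · obtain ⟨p, hp, rfl⟩ := mem_image.1 hz
    obtain ⟨p', hp', rfl⟩ := mem_image.1 hw
    rw [hρ p hp, hρ p' hp']

/-- Within classes of `ρ`, Kneser's theorem loses at most the torsion of the kernel. -/
lemma card_add_card_le_card_add_add_card_ker [Finite G] {ρ : ℤ × G →+ Γ} {X Y : Finset (ℤ × G)}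
    {c e : Γ} (hX : X.Nonempty) (hY : Y.Nonempty) (hXc : ∀ z ∈ X, ρ z = c)
    (hYe : ∀ z ∈ Y, ρ z = e) :
    #X + #Y ≤ #(X + Y) + Nat.card (ρ.comp (AddMonoidHom.inr ℤ G)).ker := by
  obtain ⟨S, hS, hle⟩ := kneser hX hY
  have hfin := finite_of_add_mem (hX.add hY) hS
  refine hle.trans (Nat.add_le_add_left ?_ _)
  obtain ⟨F, hF, hcard⟩ := exists_finset_of_finite S
  rw [← hcard]
  have hρ : ∀ z ∈ X + Y, ρ z = c + e := by
    intro z hz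
    obtain ⟨x, hx, y, hy, rfl⟩ := mem_add.1 hz
    rw [map_add, hXc x hx, hYe y hy]
  refine card_le_card_ker_inr (i := 0) (c := 0) (fun z hz => ?_) fun z hz => ?_
  -- A period has finite order, so its integer coordinate vanishes.
  · have hfo : IsOfFinAddOrder (⟨z, (hF z).1 hz⟩ : S) := isOfFinAddOrder_of_finite _
    obtain ⟨n, hn, hnz⟩ := isOfFinAddOrder_iff_nsmul_eq_zero.1 hfo
    have h1 : n • z = 0 := by simpa using congrArg Subtype.val hnz
    have h2 : n • z.1 = 0 := by simpa using congrArg Prod.fst h1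
    rcases smul_eq_zero.1 h2 with h | h
    · omega
    · exact h
  · obtain ⟨w, hw⟩ := hX.add hY
    have := hρ _ (hS w hw z ((hF z).1 hz))
    rw [map_add, hρ w hw] at this
    simpa using this

end Fibers

/-! ### Lower bounds for `B + B` from pairs of classes. -/

section Classes

open Finset

variable {G Γ : Type*} [AddCommGroup G] [AddCommGroup Γ] [DecidableEq G] [DecidableEq Γ]

lemma sum_card_filter_add_le {ρ : ℤ × G →+ Γ} {B : Finset (ℤ × G)} (T : Finset Γ) :
    ∑ γ ∈ T, #((B + B).filter fun z => ρ z = γ) ≤ #(B + B) :=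
  (sum_card_fiberwise_eq_card_filter (B + B) T ρ).trans_le (card_filter_le _ _)

lemma card_filter_add_card_filter_le [Finite G] {ρ : ℤ × G →+ Γ} {B : Finset (ℤ × G)} {δ ε : Γ}
    (hδ : δ ∈ B.image ρ) (hε : ε ∈ B.image ρ) :
    #(B.filter fun z => ρ z = δ) + #(B.filter fun z => ρ z = ε)
      ≤ #((B + B).filter fun z => ρ z = δ + ε)
        + Nat.card (ρ.comp (AddMonoidHom.inr ℤ G)).ker := by
  obtain ⟨x, hx, hxδ⟩ := mem_image.1 hδ
  obtain ⟨y, hy, hyε⟩ := mem_image.1 hε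
  refine (card_add_card_le_card_add_add_card_ker (ρ := ρ) (c := δ) (e := ε)
    ⟨x, mem_filter.2 ⟨hx, hxδ⟩⟩ ⟨y, mem_filter.2 ⟨hy, hyε⟩⟩ (fun z hz => (mem_filter.1 hz).2)
    fun z hz => (mem_filter.1 hz).2).trans (Nat.add_le_add_right (card_le_card fun z hz => ?_) _)
  obtain ⟨u, hu, v, hv, rfl⟩ := mem_add.1 hz
  rw [mem_filter] at hu hv
  exact mem_filter.2 ⟨add_mem_add hu.1 hv.1, by rw [map_add, hu.2, hv.2]⟩

lemma three_mul_card_le_of_two_classes [Finite G] {ρ : ℤ × G →+ Γ} {B : Finset (ℤ × G)}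
    (hk : #(B.image ρ) = 2) (hkn : 3 ≤ #(B.image ρ + B.image ρ)) :
    3 * #B ≤ #(B + B) + 3 * Nat.card (ρ.comp (AddMonoidHom.inr ℤ G)).ker := by
  have hn := card_eq_sum_card_image ρ B
  have hτ := sum_card_filter_add_le (ρ := ρ) (B := B)
  have hpair := fun δ ε => card_filter_add_card_filter_le (ρ := ρ) (B := B) (δ := δ) (ε := ε)
  generalize B.image ρ = D at *
  obtain ⟨x, y, hxy, rfl⟩ := card_eq_two.1 hk
  rw [sum_pair hxy] at hn
  have hne : x + x ≠ y + y := by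
    intro h
    have : ({x, y} : Finset Γ) + {x, y} ⊆ {x + x, x + y} := by
      intro z hz
      simp only [mem_add, mem_insert, mem_singleton] at hz ⊢
      obtain ⟨u, rfl | rfl, v, rfl | rfl, rfl⟩ := hz
      · simp
      · simp
      · right; exact add_comm _ _
      · left; exact h.symm
    have h2 := (card_le_card this).trans card_le_two
    omega
  have h1 := hτ {x + x, x + y, y + y}
  rw [sum_insert (by simp [hxy, hne]), sum_pair (by simpa using hxy)] at h1
  have hx := hpair x x (by simp) (by simp)
  have hy := hpair x y (by simp) (by simp)
  have hz := hpair y y (by simp) (by simp)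
  omega

/-- Besides `x + x`, `x + y`, `x + z`, at least two of `y + y`, `y + z`, `z + z` give new classes.
The cheapest two are `y + z` and `z + z`, as the class of `z` is no larger than that of `y`. -/
lemma card_le_of_three_classes [Finite G] {ρ : ℤ × G →+ Γ} {B : Finset (ℤ × G)} {x y z : Γ}
    (hxy : x ≠ y) (hxz : x ≠ z) (hyz : y ≠ z) (hD : B.image ρ = {x, y, z})
    (hkn : 5 ≤ #(B.image ρ + B.image ρ))
    (h₁ : #(B.filter fun w => ρ w = z) ≤ #(B.filter fun w => ρ w = y)) :
    #B + 3 * #(B.filter fun w => ρ w = x) + #(B.filter fun w => ρ w = y)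
        + 3 * #(B.filter fun w => ρ w = z)
      ≤ #(B + B) + 5 * Nat.card (ρ.comp (AddMonoidHom.inr ℤ G)).ker := by
  have hn := card_eq_sum_card_image ρ B
  have hτ := sum_card_filter_add_le (ρ := ρ) (B := B)
  have hpair := fun δ ε => card_filter_add_card_filter_le (ρ := ρ) (B := B) (δ := δ) (ε := ε)
  rw [hD] at hkn hn hpair
  rw [sum_insert (by simp [hxy, hxz]), sum_pair hyz] at hn
  have hT : #({x + x, x + y, x + z} : Finset Γ) ≤ 3 := card_le_three
  have hR := le_card_sdiff ({x + x, x + y, x + z} : Finset Γ) (({x, y, z} : Finset Γ) + {x, y, z})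
  obtain ⟨γ, hγ, γ', hγ', hne⟩ := one_lt_card.1 (show 1 < #((({x, y, z} : Finset Γ) + {x, y, z}) \
    {x + x, x + y, x + z}) by omega)
  have hmem : ∀ w ∈ (({x, y, z} : Finset Γ) + {x, y, z}) \ {x + x, x + y, x + z},
      w = y + y ∨ w = y + z ∨ w = z + z := by
    intro w hw
    simp only [mem_sdiff, mem_add, mem_insert, mem_singleton, not_or] at hw
    obtain ⟨⟨u, hu, v, hv, rfl⟩, h1, h2, h3⟩ := hw
    rcases hu with rfl | rfl | rfl <;> rcases hv with rfl | rfl | rfl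
    · exact absurd rfl h1
    · exact absurd rfl h2
    · exact absurd rfl h3
    · exact absurd (add_comm _ _) h2
    · exact Or.inl rfl
    · exact Or.inr (Or.inl rfl)
    · exact absurd (add_comm _ _) h3
    · exact Or.inr (Or.inl (add_comm _ _))
    · exact Or.inr (Or.inr rfl)
  have e₁ := hpair x x (by simp) (by simp)
  have e₂ := hpair x y (by simp) (by simp)
  have e₃ := hpair x z (by simp) (by simp)
  have e₄ := hpair y y (by simp) (by simp)
  have e₅ := hpair y z (by simp) (by simp)
  have e₆ := hpair z z (by simp) (by simp)
  have hsum := hτ {γ, γ', x + x, x + y, x + z}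
  have m₁ := (mem_sdiff.1 hγ).2
  have m₂ := (mem_sdiff.1 hγ').2
  rw [sum_insert (by simpa [hne] using m₁), sum_insert m₂, sum_insert (by simp [hxy, hxz]),
    sum_pair (by simpa using hyz)] at hsum
  rcases hmem γ hγ with rfl | rfl | rfl <;> rcases hmem γ' hγ' with rfl | rfl | rfl <;>
    first
      | exact absurd rfl hne
      | omega

lemma card_le_of_class_le [Finite G] {ρ : ℤ × G →+ Γ} {B : Finset (ℤ × G)} {c r : ℕ}
    (hkn : r ≤ #(B.image ρ + B.image ρ))
    (hσ : ∀ δ ∈ B.image ρ, #B ≤ #(B.filter fun z => ρ z = δ) + c) :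
    r * (2 * #B) ≤ #(B + B) + r * (2 * c + Nat.card (ρ.comp (AddMonoidHom.inr ℤ G)).ker) := by
  obtain ⟨T, hT, rfl⟩ := exists_subset_card_eq hkn
  have h1 := sum_card_filter_add_le (ρ := ρ) (B := B) T
  have h2 : ∑ _γ ∈ T, 2 * #B ≤ ∑ γ ∈ T, (#((B + B).filter fun z => ρ z = γ)
      + (2 * c + Nat.card (ρ.comp (AddMonoidHom.inr ℤ G)).ker)) := by
    refine sum_le_sum fun γ hγ => ?_
    obtain ⟨δ, hδ, ε, hε, rfl⟩ := mem_add.1 (hT hγ)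
    have := card_filter_add_card_filter_le hδ hε
    have := hσ δ hδ
    have := hσ ε hε
    omega
  rw [sum_add_distrib, sum_const, sum_const, smul_eq_mul, smul_eq_mul] at h2
  omega

end Classes

/-! ### Only one class: excluding `k = 2, 3, 4` and `k ≥ 5`. -/

section Rigidity

open Finset

variable {G Γ : Type*} [AddCommGroup G] [AddCommGroup Γ] [DecidableEq G] [DecidableEq Γ]

/-- Lower the top fibre by `(L, b)`. Everything then lies over `[0, L)`, where each class has at
most `q` points, and the points counted twice are those of the last filter. -/
lemma card_le_card_image_mul_add_card {ρ : ℤ × G →+ Γ} {B : Finset (ℤ × G)} {L : ℤ} {b : G}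
    {q : ℕ} (hL : 0 < L) (hρ : ρ (L, b) = 0) (hr : ∀ z ∈ B, 0 ≤ z.1 ∧ z.1 ≤ L)
    (hbox : ∀ X : Finset (ℤ × G), (∀ z ∈ X, 0 ≤ z.1 ∧ z.1 < L) →
      (∀ z ∈ X, ∀ w ∈ X, ρ z = ρ w) → #X ≤ q) :
    #B ≤ #(B.image ρ) * q + #(B.filter fun z => z.1 = 0 ∧ z + (L, b) ∈ B) := by
  set U := B.filter fun z => z.1 < L with hU
  set V := (B.filter fun z => ¬ z.1 < L).image (· - (L, b)) with hV
  have hV' : ∀ w ∈ V, w.1 = 0 ∧ w + (L, b) ∈ B := by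
    intro w hw
    obtain ⟨z, hz, rfl⟩ := mem_image.1 hw
    obtain ⟨hz, hzL⟩ := mem_filter.1 hz
    have := hr z hz
    refine ⟨?_, by simpa using hz⟩
    simp only [Prod.fst_sub]
    omega
  have hcV : #V = #(B.filter fun z => ¬ z.1 < L) :=
    card_image_of_injective _ sub_left_injective
  have hsplit : #U + #V = #B := by rw [hcV]; exact card_filter_add_card_filter_not _
  have hinter : #(U ∩ V) ≤ #(B.filter fun z => z.1 = 0 ∧ z + (L, b) ∈ B) := by
    refine card_le_card fun z hz => ?_
    rw [mem_inter] at hz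
    exact mem_filter.2 ⟨(mem_filter.1 hz.1).1, hV' z hz.2⟩
  have hunion : #(U ∪ V) ≤ q * #(B.image ρ) := by
    refine (card_le_mul_card_image (f := ρ) _ q fun c _ => hbox _ (fun z hz => ?_)
      fun z hz w hw => ?_).trans (Nat.mul_le_mul_left _ (card_le_card fun c hc => ?_))
    · rcases mem_union.1 (mem_filter.1 hz).1 with h | h
      · exact ⟨(hr z (mem_filter.1 h).1).1, (mem_filter.1 h).2⟩
      · rw [(hV' z h).1]; exact ⟨le_rfl, hL⟩
    · rw [(mem_filter.1 hz).2, (mem_filter.1 hw).2]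
    · obtain ⟨z, hz, rfl⟩ := mem_image.1 hc
      rcases mem_union.1 hz with h | h
      · exact mem_image_of_mem _ (mem_filter.1 h).1
      · refine mem_image.2 ⟨_, (hV' z h).2, by rw [map_add, hρ, add_zero]⟩
  have := card_union_add_card_inter U V
  rw [mul_comm] at hunion
  omega

/-- The numerical contradiction for four classes that do not all meet the fibre over zero. -/
lemma four_classes_false {n n₂ m h ℓ k₀ k₁ X : ℕ} (hk : k₀ + k₁ = 4) (hk₁ : k₁ ≠ 0)
    (hdbl : 2 * n₂ < 5 * n) (hX : 7 * (ℓ * h) + X ≤ n₂) (hn : n ≤ X)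
    (hm : n ≤ 4 * (ℓ * h) + m) (hm₀ : m ≤ k₀ * h) (hs : 6 ≤ ℓ + 1 + k₁ * ℓ)
    (hr₁ : ∀ r, r + ℓ + 1 ≤ 6 → n + r * m ≤ X + k₁ * (ℓ * h))
    (hr₂ : ∀ r, r + ℓ + 1 ≤ 6 → n + r * m ≤ X + r * (k₁ * h)) : False := by
  -- From `14ℓh + 2n ≤ 2n₂ < 5n` and `n ≤ 4ℓh + k₀h`.
  have h1 : 2 * ℓ < 3 * k₀ := by
    have : (2 * ℓ) * h < (3 * k₀) * h := by nlinarith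
    exact lt_of_mul_lt_mul_right this (Nat.zero_le h)
  have hk₀ : k₀ ≤ 3 := by omega
  obtain rfl : k₁ = 4 - k₀ := by omega
  interval_cases k₀
  · omega
  · have : ℓ ≤ 1 := by omega
    interval_cases ℓ <;> omega
  · have : ℓ ≤ 2 := by omega
    interval_cases ℓ
    · omega
    · omega
    · have := hr₁ 3 (by norm_num)
      omega
  · have : ℓ ≤ 4 := by omega
    interval_cases ℓ
    · omega
    · omega
    · omega
    · have := hr₂ 2 (by norm_num)
      omega
    · have := hr₂ 1 (by norm_num)
      omega

/-- A set with doubling below `5 / 2` and at least six fibres lies in one class of `ρ`, if the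
classes of `ρ` satisfy the inequalities provided by Kneser's theorem. -/
theorem card_image_le_one [Finite G] {ρ : ℤ × G →+ Γ} {B : Finset (ℤ × G)} {L : ℤ} {b : G}
    {ℓ : ℕ} (hL : 0 < L) (h0 : 0 ∈ B) (hg : (L, b) ∈ B) (hρ : ρ (L, b) = 0)
    (hr : ∀ z ∈ B, 0 ≤ z.1 ∧ z.1 ≤ L) (hs : 6 ≤ #(B.image Prod.fst))
    (hdbl : 2 * #(B + B) < 5 * #B)
    (hbox : ∀ X : Finset (ℤ × G), (∀ z ∈ X, 0 ≤ z.1 ∧ z.1 < L) →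
      (∀ z ∈ X, ∀ w ∈ X, ρ z = ρ w) →
        #X ≤ ℓ * Nat.card (ρ.comp (AddMonoidHom.inr ℤ G)).ker)
    (hsum : #(B.image ρ + B.image ρ) * (ℓ * Nat.card (ρ.comp (AddMonoidHom.inr ℤ G)).ker)
      + ∑ i ∈ B.image Prod.fst, max #(B.filter fun z => z.1 = i)
          #(B.filter fun z => z.1 = 0 ∧ z + (L, b) ∈ B) ≤ #(B + B))
    (hkn : 2 * #(B.image ρ) ≤ #(B.image ρ + B.image ρ) + 1) :
    #(B.image ρ) ≤ 1 := by
  classical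
  set h := Nat.card (ρ.comp (AddMonoidHom.inr ℤ G)).ker with hh
  have hpos : 0 < h := Nat.card_pos
  have hB₂ := card_le_card_image_mul_add_card hL hρ hr hbox
  set M := B.filter fun z => z.1 = 0 ∧ z + (L, b) ∈ B with hM
  set A := B.image Prod.fst with hA
  set D := B.image ρ with hD
  set X := ∑ i ∈ A, max #(B.filter fun z => z.1 = i) #M with hX
  -- `D₀` collects the classes meeting level `0` of the ambient group, `A₀` the levels of `B` met by
  -- `ker ρ`. Over a level outside `A₀`, only classes outside `D₀` occur.
  set D₀ := D.filter fun δ => ∃ x, ρ (0, x) = δ with hD₀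
  set D₁ := D.filter fun δ => ¬ ∃ x, ρ (0, x) = δ with hD₁
  have hDD : #D₀ + #D₁ = #D := card_filter_add_card_filter_not _
  set A₀ := A.filter fun i => ∃ x, ρ (i, x) = 0 with hA₀
  set A₁ := A.filter fun i => ¬ ∃ x, ρ (i, x) = 0 with hA₁
  have hAA : #A₀ + #A₁ = #A := card_filter_add_card_filter_not _
  have hBX : ∑ i ∈ A, #(B.filter fun z => z.1 = i) = #B := (card_eq_sum_card_image _ _).symm
  have hAr : ∀ i ∈ A, 0 ≤ i ∧ i ≤ L := by
    intro i hi
    obtain ⟨z, hz, rfl⟩ := mem_image.1 hi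
    exact hr z hz
  have hbig : ∀ z : ℤ × G, z.1 = L → ∃ x, ρ (0, x) = ρ z := by
    intro z hz
    refine ⟨z.2 - b, ?_⟩
    have : ((0, z.2 - b) : ℤ × G) = z - (L, b) := by ext <;> simp [hz]
    rw [this, map_sub, hρ, sub_zero]
  have hclass : ∀ z ∈ B, z.1 ∈ A₁ → ρ z ∈ D₁ := by
    intro z hz hz₁
    refine mem_filter.2 ⟨mem_image_of_mem _ hz, ?_⟩
    rintro ⟨x, hx⟩
    refine (mem_filter.1 hz₁).2 ⟨z.2 - x, ?_⟩
    have : ((z.1, z.2 - x) : ℤ × G) = z - (0, x) := by ext <;> simp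
    rw [this, map_sub, hx, sub_self]
  have hA₁L : ∀ i ∈ A₁, 0 ≤ i ∧ i < L := by
    intro i hi
    obtain ⟨hi, hi'⟩ := mem_filter.1 hi
    refine ⟨(hAr i hi).1, lt_of_le_of_ne (hAr i hi).2 ?_⟩
    rintro rfl
    exact hi' ⟨b, hρ⟩
  have hM₀ : #M ≤ #D₀ * h := by
    rw [mul_comm]
    refine (card_le_mul_card_image (f := ρ) M h fun c _ => card_le_card_ker_inr (i := 0) (c := c)
      (fun z hz => (mem_filter.1 (mem_filter.1 hz).1).2.1) fun z hz => (mem_filter.1 hz).2).trans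
      (Nat.mul_le_mul_left _ (card_le_card fun c hc => ?_))
    obtain ⟨z, hz, rfl⟩ := mem_image.1 hc
    obtain ⟨hz, hz0, -⟩ := mem_filter.1 hz
    exact mem_filter.2 ⟨mem_image_of_mem _ hz, z.2, by rw [← hz0]⟩
  have hσ₁ : ∀ δ, δ ∉ D₀ → #(B.filter fun z => ρ z = δ) ≤ ℓ * h := by
    intro δ hδ
    refine hbox _ (fun z hz => ?_) fun z hz w hw => ?_
    · obtain ⟨hzB, hzδ⟩ := mem_filter.1 hz
      refine ⟨(hr z hzB).1, lt_of_le_of_ne (hr z hzB).2 fun hzL => hδ ?_⟩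
      exact mem_filter.2 ⟨hzδ ▸ mem_image_of_mem _ hzB, hzδ ▸ hbig z hzL⟩
    · rw [(mem_filter.1 hz).2, (mem_filter.1 hw).2]
  have hσ₀ : ∀ δ, #(B.filter fun z => ρ z = δ) ≤ ℓ * h + h := by
    intro δ
    rw [← card_filter_add_card_filter_not (s := B.filter fun z => ρ z = δ) (fun z => z.1 < L)]
    refine add_le_add (hbox _ (fun z hz => ?_) fun z hz w hw => ?_)
      (card_le_card_ker_inr (i := L) (c := δ) (fun z hz => ?_) fun z hz => ?_)
    · obtain ⟨hz, hzL⟩ := mem_filter.1 hz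
      exact ⟨(hr z (mem_filter.1 hz).1).1, hzL⟩
    · rw [(mem_filter.1 (mem_filter.1 hz).1).2, (mem_filter.1 (mem_filter.1 hw).1).2]
    · obtain ⟨hz, hzL⟩ := mem_filter.1 hz
      have := hr z (mem_filter.1 hz).1
      omega
    · exact (mem_filter.1 (mem_filter.1 hz).1).2
  have hcardN : ∀ (N : Finset ℤ) (c : Γ), (∀ i ∈ N, 0 ≤ i ∧ i < L) →
      (∀ i ∈ N, ∃ x, ρ (i, x) = c) → #N ≤ ℓ := fun N c hN hc =>
    le_of_mul_le_mul_right (card_mul_card_ker_le hbox hN hc) hpos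
  have hA₀card : #A₀ ≤ ℓ + 1 := by
    have h1 : A₀ ⊆ insert L (A₀.filter fun i => i < L) := by
      intro i hi
      have := hAr i (mem_filter.1 hi).1
      rcases this.2.lt_or_eq with h | h
      · exact mem_insert_of_mem (mem_filter.2 ⟨hi, h⟩)
      · rw [h]; exact mem_insert_self _ _
    refine (card_le_card h1).trans ((card_insert_le _ _).trans (Nat.add_le_add_right ?_ _))
    refine hcardN _ 0 (fun i hi => ?_) fun i hi => (mem_filter.1 (mem_filter.1 hi).1).2
    obtain ⟨hi, hiL⟩ := mem_filter.1 hi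
    exact ⟨(hAr i (mem_filter.1 hi).1).1, hiL⟩
  have hA₁card : #A₁ ≤ #D₁ * ℓ := by
    have h1 : A₁ ⊆ D₁.biUnion fun δ => A₁.filter fun i => ∃ x, ρ (i, x) = δ := by
      intro i hi
      obtain ⟨z, hz, rfl⟩ := mem_image.1 (mem_filter.1 hi).1
      exact mem_biUnion.2 ⟨ρ z, hclass z hz hi, mem_filter.2 ⟨hi, z.2, rfl⟩⟩
    refine (card_le_card h1).trans (card_biUnion_le_card_mul _ _ _ fun δ _ => ?_)
    exact hcardN _ δ (fun i hi => hA₁L i (mem_filter.1 hi).1) fun i hi => (mem_filter.1 hi).2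
  have hfib : ∀ i ∈ A₁, #(B.filter fun z => z.1 = i) ≤ #D₁ * h := by
    intro i hi
    rw [mul_comm]
    refine (card_le_mul_card_image (f := ρ) _ h fun c _ => card_le_card_ker_inr (i := i) (c := c)
      (fun z hz => (mem_filter.1 (mem_filter.1 hz).1).2) fun z hz => (mem_filter.1 hz).2).trans
      (Nat.mul_le_mul_left _ (card_le_card fun c hc => ?_))
    obtain ⟨z, hz, rfl⟩ := mem_image.1 hc
    obtain ⟨hzB, hzi⟩ := mem_filter.1 hz
    exact hclass z hzB (hzi ▸ hi)
  have hnz : ∑ i ∈ A₁, #(B.filter fun z => z.1 = i) ≤ #D₁ * (ℓ * h) := by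
    rw [sum_card_fiberwise_eq_card_filter, mul_comm]
    refine (card_le_mul_card_image (f := ρ) _ (ℓ * h) fun c _ => hbox _ (fun z hz => ?_)
      fun z hz w hw => ?_).trans (Nat.mul_le_mul_left _ (card_le_card fun c hc => ?_))
    · exact hA₁L _ (mem_filter.1 (mem_filter.1 hz).1).2
    · rw [(mem_filter.1 hz).2, (mem_filter.1 hw).2]
    · obtain ⟨z, hz, rfl⟩ := mem_image.1 hc
      exact hclass z (mem_filter.1 hz).1 (mem_filter.1 hz).2
  have hsX : #A * #M ≤ X := by
    rw [hX, ← smul_eq_mul, ← sum_const]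
    exact sum_le_sum fun i _ => le_max_right _ _
  have h6X : 6 * #M ≤ X := (Nat.mul_le_mul_right _ hs).trans hsX
  have hnX : #B ≤ X := by
    rw [← hBX]
    exact sum_le_sum fun i _ => le_max_left _ _
  have hT : ∀ T ⊆ A₁, #B + #T * #M ≤ X + ∑ i ∈ T, #(B.filter fun z => z.1 = i) := by
    intro T hT
    have hTA : T ⊆ A := hT.trans (filter_subset _ _)
    rw [← hBX, hX, ← sum_sdiff hTA, ← sum_sdiff (f := fun i => max _ _) hTA, ← smul_eq_mul,
      ← sum_const]
    have e1 : ∑ i ∈ A \ T, #(B.filter fun z => z.1 = i)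
        ≤ ∑ i ∈ A \ T, max #(B.filter fun z => z.1 = i) #M :=
      sum_le_sum fun i _ => le_max_left _ _
    have e2 : ∑ _i ∈ T, #M ≤ ∑ i ∈ T, max #(B.filter fun z => z.1 = i) #M :=
      sum_le_sum fun i _ => le_max_right _ _
    omega
  have hr₁ : ∀ r, r + ℓ + 1 ≤ 6 → #B + r * #M ≤ X + #D₁ * (ℓ * h) := by
    intro r hr6
    obtain ⟨T, hTA, rfl⟩ := exists_subset_card_eq (show r ≤ #A₁ by omega)
    exact (hT T hTA).trans (Nat.add_le_add_left ((sum_le_sum_of_subset hTA).trans hnz) _)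
  have hr₂ : ∀ r, r + ℓ + 1 ≤ 6 → #B + r * #M ≤ X + r * (#D₁ * h) := by
    intro r hr6
    obtain ⟨T, hTA, rfl⟩ := exists_subset_card_eq (show r ≤ #A₁ by omega)
    refine (hT T hTA).trans (Nat.add_le_add_left ?_ _)
    exact sum_le_card_nsmul _ _ _ fun i hi => hfib i (hTA hi)
  have hD₀pos : 1 ≤ #D₀ :=
    card_pos.2 ⟨0, mem_filter.2 ⟨mem_image.2 ⟨0, h0, map_zero _⟩, 0, map_zero ρ⟩⟩
  have hs' : 6 ≤ ℓ + 1 + #D₁ * ℓ := by omega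
  have hnσ : #B = ∑ δ ∈ D, #(B.filter fun z => ρ z = δ) := card_eq_sum_card_image _ _
  have hkn' : 2 * (#D * (ℓ * h)) ≤ #(D + D) * (ℓ * h) + ℓ * h := by
    have := Nat.mul_le_mul_right (ℓ * h) hkn
    rw [add_mul, one_mul, mul_assoc] at this
    exact this
  have hp : 0 < ℓ * h := by
    refine (hbox {0} ?_ ?_).trans_lt' ?_ <;> simp [hL]
  -- With `p = ℓh`, `k = #D`, `m = #M`: since `X ≥ n` and `X ≥ 6m`, `2X ≥ (7n + 18m)/5`. Together
  -- with `n ≤ kp + m` and `2(2k - 1)p + 2X < 5n` this gives `4k - 2 < 18k/5`.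
  have hk4 : #D < 5 := by
    refine lt_of_mul_lt_mul_right (a := ℓ * h) ?_ (Nat.zero_le _)
    omega
  by_contra hk1
  have hk : #D = 2 ∨ #D = 3 ∨ #D = 4 := by omega
  rcases hk with hk | hk | hk
  -- The pair bound gives `n < 6h`, while the lifted bound gives `n > 2ℓh ≥ 6h`.
  · have h3 := three_mul_card_le_of_two_classes hk (show 3 ≤ #(D + D) by omega)
    have hℓ : 3 ≤ ℓ := by
      have : #D₁ ≤ 1 := by omega
      interval_cases #D₁ <;> omega
    have hp3 := Nat.mul_le_mul_right h hℓ
    rw [hk] at hkn'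
    omega
  · obtain ⟨x, hx, hmax⟩ := exists_max_image D (fun δ => #(B.filter fun z => ρ z = δ))
      (card_pos.1 (by omega))
    obtain ⟨y, z, hyz, hE⟩ := card_eq_two.1 (show #(D.erase x) = 2 by rw [card_erase_of_mem hx, hk])
    wlog hle : #(B.filter fun w => ρ w = z) ≤ #(B.filter fun w => ρ w = y) generalizing y z
    · exact this z y hyz.symm (by rw [hE, pair_comm]) (le_of_not_ge hle)
    have hDx : D = {x, y, z} := by rw [← insert_erase hx, hE]
    have hy : y ∈ D.erase x := by rw [hE]; simp
    have hz : z ∈ D.erase x := by rw [hE]; simp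
    obtain ⟨hyx, hyD⟩ := mem_erase.1 hy
    obtain ⟨hzx, hzD⟩ := mem_erase.1 hz
    have h3 := card_le_of_three_classes hyx.symm hzx.symm hyz hDx (show 5 ≤ #(D + D) by omega) hle
    rw [hDx, sum_insert (by simp [hyx.symm, hzx.symm]), sum_pair hyz] at hnσ
    have hyσ := hmax y hyD
    have hzσ := hmax z hzD
    rw [hk] at hkn' hB₂
    -- For `ℓ ≥ 3` the bounds `n < 10h` and `3n > 10ℓh` collide. Otherwise six levels force `ℓ = 2`
    -- with one class in `D₀`, and the other two have at most `2h` elements each.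
    by_cases hℓ : 3 ≤ ℓ
    · have hp3 := Nat.mul_le_mul_right h hℓ
      omega
    · have hD₁2 : #D₁ ≤ 2 := by omega
      have hℓ2 : ℓ = 2 ∧ #D₀ = 1 := by
        have : ℓ ≤ 2 := by omega
        interval_cases ℓ
        · omega
        · omega
        · exact ⟨rfl, by omega⟩
      obtain ⟨rfl, hD₀1⟩ := hℓ2
      have hxD₀ : x ∈ D₀ := by
        by_contra hxD₀
        have := hσ₁ x hxD₀
        omega
      have hyD₀ : y ∉ D₀ := fun hyD₀ => hyx (card_le_one.1 hD₀1.le y hyD₀ x hxD₀)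
      have := hσ₁ y hyD₀
      omega
  · rw [hk] at hkn' hB₂
    by_cases hD₁0 : #D₁ = 0
    · have hD₀4 : #D₀ = 4 := by omega
      rw [hD₁0] at hs'
      rw [hD₀4] at hM₀
      have hℓ : ℓ = 5 := by
        have : ℓ * h < 6 * h := by omega
        have := lt_of_mul_lt_mul_right this (Nat.zero_le h)
        omega
      subst hℓ
      -- The other three classes have at most `6h` elements each. Seven sums then give `23n < 518h`,
      -- against `3n > 70h`.
      have h7 := card_le_of_class_le (ρ := ρ) (B := B) (c := 18 * h) (r := 7) (show 7 ≤ #(D + D) by omega)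
        (fun δ hδ => by
          rw [hnσ, ← add_sum_erase _ _ hδ]
          refine Nat.add_le_add_left ?_ _
          refine (sum_le_card_nsmul _ _ (6 * h) fun ε _ => ?_).trans ?_
          · have := hσ₀ ε
            omega
          · rw [card_erase_of_mem hδ, hk, smul_eq_mul]
            omega)
      omega
    · refine four_classes_false (by omega) hD₁0 hdbl (X := X) ?_ hnX hB₂ hM₀ hs' hr₁ hr₂
      omega

end Rigidity

/-! ### The covering subgroup `ker ρ`. -/

section Cover

open Finset

variable {G : Type*} [AddCommGroup G] [DecidableEq G]

/-- A set in `ℤ × G` with at least six fibres over `[0, L]` and doubling below `5 / 2` lies in a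
subgroup `K` with `L |K ∩ ({0} × G)| ≤ |B + B| - |B|`. -/
theorem exists_addSubgroup_of_small_doubling [Finite G] {B : Finset (ℤ × G)} {L : ℤ} {b : G}
    (hL : 0 < L) (h0 : 0 ∈ B) (hg : (L, b) ∈ B) (hr : ∀ z ∈ B, 0 ≤ z.1 ∧ z.1 ≤ L)
    (hs : 6 ≤ #(B.image Prod.fst)) (hdbl : 2 * #(B + B) < 5 * #B) :
    ∃ K : AddSubgroup (ℤ × G), (∀ z ∈ B, z ∈ K) ∧ ∀ x, ((1, x) : ℤ × G) ∈ K →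
      L * (Nat.card (K.comap (AddMonoidHom.inr ℤ G)) : ℤ) + #B ≤ #(B + B) := by
  classical
  set φ := QuotientAddGroup.mk' (AddSubgroup.zmultiples ((L, b) : ℤ × G)) with hφ
  have hφg : φ (L, b) = 0 :=
    (QuotientAddGroup.eq_zero_iff _).2 (AddSubgroup.mem_zmultiples _)
  have hC : (B.image φ).Nonempty := ⟨_, mem_image_of_mem _ h0⟩
  obtain ⟨S, hSfin, hper, hkn⟩ := kneser_quotient hC hC
  set ψ := QuotientAddGroup.mk' S with hψ
  set ρ := ψ.comp φ with hρ
  have himg : (B.image φ).image ψ = B.image ρ := image_image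
  have himg₂ : (B.image φ + B.image φ).image ψ = B.image ρ + B.image ρ := by
    rw [image_add, himg]
  have hCC : (B + B).image φ = B.image φ + B.image φ := image_add _
  have hcard := card_eq_card_image_mk_mul hper
  rw [← hψ, himg₂] at hcard
  have hkn := hkn inferInstance
  rw [himg₂, himg, ← two_mul] at hkn
  have hbox : ∀ X : Finset (ℤ × G), (∀ z ∈ X, 0 ≤ z.1 ∧ z.1 < L) →
      (∀ z ∈ X, ∀ w ∈ X, ρ z = ρ w) → #X ≤ Nat.card S := by
    intro X hX hXρ
    rcases X.eq_empty_or_nonempty with rfl | ⟨w, hw⟩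
    · simp
    have hinj : Set.InjOn φ (X : Set (ℤ × G)) := by
      intro u hu v hv huv
      obtain ⟨j, hj⟩ := AddSubgroup.mem_zmultiples_iff.1 (QuotientAddGroup.eq.1 huv)
      have h1 : j * L = -u.1 + v.1 := by simpa using congrArg Prod.fst hj
      have hu' := hX u hu
      have hv' := hX v hv
      have hj0 : j = 0 := by
        by_contra hj0
        rcases lt_or_gt_of_ne hj0 with h | h <;> nlinarith
      rw [hj0, zero_smul] at hj
      exact (neg_add_eq_zero.1 hj.symm)
    rw [← card_image_of_injOn hinj]
    refine card_le_card_of_sub_mem (φ w) fun q hq => ?_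
    obtain ⟨z, hz, rfl⟩ := mem_image.1 hq
    rw [← QuotientAddGroup.eq_zero_iff]
    have : ψ (φ z) = ψ (φ w) := hXρ z hz w hw
    change ψ (φ z - φ w) = 0
    rw [map_sub, this, sub_self]
  -- The torsion part of `ker ρ` embeds in `S`, because nonzero multiples of `(L, b)` leave level
  -- `0`. The quotient `ℓ` bounds the number of levels in `[0, L)` met by one class.
  have hdvd : Nat.card (ρ.comp (AddMonoidHom.inr ℤ G)).ker ∣ Nat.card S := by
    refine AddSubgroup.card_dvd_of_injective
      (((φ.comp (AddMonoidHom.inr ℤ G)).comp (AddSubgroup.subtype _)).codRestrict S ?_) ?_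
    · rintro ⟨x, hx⟩
      exact (QuotientAddGroup.eq_zero_iff _).1 hx
    · intro x y hxy
      have h1 : φ (0, (x : G)) = φ (0, (y : G)) := congrArg Subtype.val hxy
      obtain ⟨j, hj⟩ := AddSubgroup.mem_zmultiples_iff.1 (QuotientAddGroup.eq.1 h1)
      have h2 : j = 0 ∨ L = 0 := by simpa using congrArg Prod.fst hj
      rcases h2 with rfl | h2
      · have h3 : (0 : G) = -x + y := by simpa using congrArg Prod.snd hj
        exact Subtype.ext (neg_add_eq_zero.1 h3.symm)
      · omega
  obtain ⟨ℓ, hℓ⟩ := hdvd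
  rw [mul_comm] at hℓ
  have hsum := card_image_add_sum_max_le (M := B.filter fun z => z.1 = 0 ∧ z + (L, b) ∈ B)
    hL h0 hg hφg fun z hz => by simpa using hz
  rw [hCC, hcard] at hsum
  have hρg : ρ (L, b) = 0 := by rw [hρ, AddMonoidHom.comp_apply, hφg, map_zero]
  have hone := card_image_le_one hL h0 hg hρg hr hs hdbl (hℓ ▸ hbox) (hℓ ▸ hsum) hkn
  refine ⟨ρ.ker, fun z hz => ?_, fun x hx => ?_⟩
  · rw [AddMonoidHom.mem_ker, ← map_zero ρ]
    exact card_le_one.1 hone _ (mem_image_of_mem _ hz) _ (mem_image_of_mem _ h0)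
  · have h1 : #(Ico 0 L) * Nat.card (ρ.comp (AddMonoidHom.inr ℤ G)).ker ≤ Nat.card S := by
      refine card_mul_card_ker_le hbox (c := 0) (fun i hi => mem_Ico.1 hi) fun i _ => ⟨i • x, ?_⟩
      have : ((i, i • x) : ℤ × G) = i • (1, x) := by simp
      rw [this, map_zsmul, AddMonoidHom.mem_ker.1 hx, smul_zero]
    have h2 : #B ≤ ∑ i ∈ B.image Prod.fst, max #(B.filter fun z => z.1 = i)
        #(B.filter fun z => z.1 = 0 ∧ z + (L, b) ∈ B) := by
      rw [card_eq_sum_card_image Prod.fst B]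
      exact sum_le_sum fun i _ => le_max_left _ _
    have h3 : 1 * Nat.card S ≤ #(B.image ρ + B.image ρ) * Nat.card S := by
      refine Nat.mul_le_mul_right _ (card_pos.2 ?_)
      exact Nonempty.add ⟨_, mem_image_of_mem _ h0⟩ ⟨_, mem_image_of_mem _ h0⟩
    have h4 : #(Ico 0 L) * Nat.card (ρ.comp (AddMonoidHom.inr ℤ G)).ker + #B ≤ #(B + B) := by
      omega
    have h5 : ((#(Ico 0 L) : ℕ) : ℤ) = L := by simp [hL.le]
    have h6 : ρ.ker.comap (AddMonoidHom.inr ℤ G) = (ρ.comp (AddMonoidHom.inr ℤ G)).ker := rfl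
    rw [h6]
    nth_rewrite 1 [← h5]
    exact_mod_cast h4

end Cover

/-! ### A fibre of density `2/3`. -/

section LargeFiber

open Finset

/-- Pigeonhole: `X` and `x₀ + y₀ + t - Y` lie in the same coset of `S`, so they meet for every `t ∈
S`. -/
lemma card_le_card_add_of_lt {E : Type*} [AddCommGroup E] [DecidableEq E] {S : AddSubgroup E}
    [Finite S] {X Y : Finset E} (x₀ y₀ : E) (hX : ∀ x ∈ X, x - x₀ ∈ S) (hY : ∀ y ∈ Y, y - y₀ ∈ S)
    (h : Nat.card S < #X + #Y) : Nat.card S ≤ #(X + Y) := by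
  obtain ⟨F, hF, hc⟩ := exists_finset_of_finite S
  rw [← hc]
  refine card_le_card_of_injOn (x₀ + y₀ + ·) (fun t ht => ?_) fun u _ v _ huv => by simpa using huv
  have ht : t ∈ S := (hF t).1 ht
  have hcY : #(Y.image (x₀ + y₀ + t - ·)) = #Y :=
    card_image_of_injective _ sub_right_injective
  have hle : #(X ∪ Y.image (x₀ + y₀ + t - ·)) ≤ Nat.card S := by
    refine card_le_card_of_sub_mem x₀ fun z hz => ?_
    rcases mem_union.1 hz with hz | hz
    · exact hX z hz
    · obtain ⟨y, hy, rfl⟩ := mem_image.1 hz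
      have : x₀ + y₀ + t - y - x₀ = t - (y - y₀) := by abel
      rw [this]
      exact sub_mem ht (hY y hy)
  have hne : (X ∩ Y.image (x₀ + y₀ + t - ·)).Nonempty := by
    rw [← card_pos]
    have := card_union_add_card_inter X (Y.image (x₀ + y₀ + t - ·))
    omega
  obtain ⟨x, hx⟩ := hne
  obtain ⟨hx, hx'⟩ := mem_inter.1 hx
  obtain ⟨y, hy, rfl⟩ := mem_image.1 hx'
  exact mem_coe.2 (mem_add.2 ⟨_, hx, y, hy, sub_add_cancel _ _⟩)

/-- Treats the three extreme levels at one end. The bounds `fᵢ ≤ Fᵢ` alone would only give `6h`;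
filled levels save the remaining `h`. -/
lemma five_mul_le_two_mul_add {f₀ f₁ f₂ F₀ F₁ F₂ h : ℕ} (h₀ : f₀ ≤ F₀) (h₁ : f₁ ≤ F₁)
    (h₂ : f₂ ≤ F₂) (b₀ : 3 * f₀ < 2 * h) (b₁ : 3 * f₁ < 2 * h) (b₂ : 3 * f₂ < 2 * h)
    (e₁ : h < f₀ + f₁ → h ≤ F₁) (e₂ : h < f₀ + f₂ → h ≤ F₂)
    (e₃ : h < f₁ + f₁ → h ≤ F₂) :
    5 * (f₀ + f₁ + f₂) ≤ 2 * (F₀ + F₁ + F₂) + 5 * h := by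
  omega

/-- The numerical contradiction behind the existence of a fibre of density `2 / 3`. -/
lemma small_fibers_false {f F : ℕ → ℕ} {h l : ℕ} (hl : 5 ≤ l) (hf : ∀ i ≤ l, 3 * f i < 2 * h)
    (h₁ : ∀ i ≤ l, ∀ j ≤ l, f i ≤ F (i + j))
    (h₂ : ∀ i ≤ l, ∀ j ≤ l, h < f i + f j → h ≤ F (i + j))
    (hb : l * h + ∑ i ∈ range (l + 1), f i ≤ ∑ j ∈ range (2 * l + 1), F j)
    (hd : 2 * ∑ j ∈ range (2 * l + 1), F j < 5 * ∑ i ∈ range (l + 1), f i) : False := by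
  -- The deficits are positive with sum below `2h`, whereas two disjoint pairs of fibres, each of
  -- total at most `h`, would already have deficit `2h`. So one of any two disjoint pairs with index
  -- sum `j` fills level `j`.
  have hdef : ∑ i ∈ range (l + 1), (2 * (h : ℤ) - 3 * f i) < 2 * h := by
    rw [sum_sub_distrib, ← mul_sum, ← mul_sum, sum_const, card_range, nsmul_eq_mul]
    push_cast
    have : 2 * (l * h) < 3 * ∑ i ∈ range (l + 1), f i := by omega
    zify at this
    linarith
  have hquad : ∀ a b c d : ℕ, a < b → b < c → c < d → d ≤ l →
      f a + f d ≤ h → f b + f c ≤ h → False := by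
    intro a b c d hab hbc hcd hdl had hbc'
    have hsub : ({a, b, c, d} : Finset ℕ) ⊆ range (l + 1) := by
      intro x hx
      simp only [mem_insert, mem_singleton] at hx
      rw [mem_range]
      omega
    have := sum_le_sum_of_subset_of_nonneg (f := fun i => 2 * (h : ℤ) - 3 * f i) hsub
      fun i hi _ => by
        have := hf i (by rw [mem_range] at hi; omega)
        omega
    rw [sum_insert (by simp; omega), sum_insert (by simp; omega), sum_pair (by omega)] at this
    omega
  have hmid : ∀ j, 3 ≤ j → j + 3 ≤ 2 * l → h ≤ F j := by
    intro j hj hj'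
    by_contra hlt
    rcases le_total j l with hjl | hjl
    · refine hquad 0 1 (j - 1) j (by omega) (by omega) (by omega) hjl ?_ ?_
      · by_contra hc
        have := h₂ 0 (by omega) j hjl (by omega)
        rw [zero_add] at this
        exact hlt this
      · by_contra hc
        have := h₂ 1 (by omega) (j - 1) (by omega) (by omega)
        rw [show 1 + (j - 1) = j by omega] at this
        exact hlt this
    · refine hquad (j - l) (j - l + 1) (l - 1) l (by omega) (by omega) (by omega) le_rfl ?_ ?_
      · by_contra hc
        have := h₂ (j - l) (by omega) l le_rfl (by omega)
        rw [show j - l + l = j by omega] at this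
        exact hlt this
      · by_contra hc
        have := h₂ (j - l + 1) (by omega) (l - 1) (by omega) (by omega)
        rw [show j - l + 1 + (l - 1) = j by omega] at this
        exact hlt this
  obtain ⟨r, rfl⟩ := Nat.exists_eq_add_of_le' hl
  have hlow := five_mul_le_two_mul_add (h₁ 0 (by omega) 0 (by omega)) (h₁ 1 (by omega) 0 (by omega))
    (h₁ 2 (by omega) 0 (by omega)) (hf 0 (by omega)) (hf 1 (by omega)) (hf 2 (by omega))
    (fun hc => h₂ 1 (by omega) 0 (by omega) (by omega))
    (fun hc => h₂ 2 (by omega) 0 (by omega) (by omega)) (h₂ 1 (by omega) 1 (by omega))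
  have hhigh := five_mul_le_two_mul_add (h₁ (r + 5) le_rfl (r + 5) le_rfl)
    (h₁ (r + 4) (by omega) (r + 5) le_rfl) (h₁ (r + 3) (by omega) (r + 5) le_rfl)
    (hf (r + 5) le_rfl) (hf (r + 4) (by omega)) (hf (r + 3) (by omega))
    (fun hc => h₂ (r + 4) (by omega) (r + 5) le_rfl (by omega))
    (fun hc => h₂ (r + 3) (by omega) (r + 5) le_rfl (by omega))
    (fun hc => by
      rw [show r + 3 + (r + 5) = r + 4 + (r + 4) by omega]
      exact h₂ (r + 4) (by omega) (r + 4) (by omega) hc)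
  have hF : ∑ j ∈ range (2 * (r + 5) + 1), F j = ∑ j ∈ range (2 * r + 5), F (j + 3)
      + (F 0 + F 1 + F 2) + (F (r + 5 + (r + 5)) + F (r + 4 + (r + 5)) + F (r + 3 + (r + 5))) := by
    rw [show 2 * (r + 5) + 1 = 2 * r + 5 + 1 + 1 + 1 + 1 + 1 + 1 by omega, sum_range_succ,
      sum_range_succ, sum_range_succ, sum_range_succ', sum_range_succ', sum_range_succ',
      show r + 5 + (r + 5) = 2 * r + 5 + 1 + 1 + 1 + 1 + 1 by omega,
      show r + 4 + (r + 5) = 2 * r + 5 + 1 + 1 + 1 + 1 by omega,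
      show r + 3 + (r + 5) = 2 * r + 5 + 1 + 1 + 1 by omega]
    simp only [zero_add, add_assoc, Nat.reduceAdd]
    ring
  have hfs : ∑ i ∈ range (r + 5 + 1), f i = ∑ i ∈ range r, f (i + 3)
      + (f 0 + f 1 + f 2) + (f (r + 5) + f (r + 4) + f (r + 3)) := by
    rw [sum_range_succ, sum_range_succ, sum_range_succ, sum_range_succ', sum_range_succ',
      sum_range_succ']
    simp only [zero_add, add_assoc, Nat.reduceAdd]
    ring
  have hFmid : (2 * r + 5) * h ≤ ∑ j ∈ range (2 * r + 5), F (j + 3) := by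
    rw [← smul_eq_mul, ← card_range (2 * r + 5), ← sum_const, card_range]
    refine sum_le_sum fun j hj => hmid _ (by omega) ?_
    rw [mem_range] at hj
    omega
  have hfmid : 3 * ∑ i ∈ range r, f (i + 3) ≤ r * (2 * h) := by
    rw [mul_sum, ← smul_eq_mul (a := r), ← card_range r, ← sum_const, card_range]
    refine sum_le_sum fun i hi => (hf _ ?_).le
    rw [mem_range] at hi
    omega
  rw [hF, hfs] at hd
  -- The two ends lose `10h` and the `2r + 5` middle levels supply `2(2r + 5)h`, leaving `4rh`; the
  -- middle fibres need at most `10rh/3`.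
  nlinarith

/-- Some fibre of `B` fills two thirds of the cosets of `K ∩ ({0} × G)`. -/
theorem exists_two_mul_card_le_three_mul_card_fiber {G : Type*} [AddCommGroup G] [DecidableEq G]
    [Finite G] {B : Finset (ℤ × G)} {L : ℤ} {K : AddSubgroup (ℤ × G)}
    (hr : ∀ z ∈ B, 0 ≤ z.1 ∧ z.1 ≤ L) (hs : 6 ≤ #(B.image Prod.fst))
    (hdbl : 2 * #(B + B) < 5 * #B) (hK : ∀ z ∈ B, z ∈ K)
    (hcard : L * (Nat.card (K.comap (AddMonoidHom.inr ℤ G)) : ℤ) + #B ≤ #(B + B)) :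
    ∃ i ∈ B.image Prod.fst, 2 * Nat.card (K.comap (AddMonoidHom.inr ℤ G))
      ≤ 3 * #(B.filter fun z => z.1 = i) := by
  by_contra hcon
  push Not at hcon
  set S := (K.comap (AddMonoidHom.inr ℤ G)).map (AddMonoidHom.inr ℤ G) with hS
  have hinr : Function.Injective (AddMonoidHom.inr ℤ G) := fun x y hxy => by simpa using hxy
  have hSfin : Finite S := Set.Finite.to_subtype ((Set.toFinite _).image _)
  have hSc : Nat.card S = Nat.card (K.comap (AddMonoidHom.inr ℤ G)) :=
    AddSubgroup.card_map_of_injective hinr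
  rw [← hSc] at hcon hcard
  have hpos : 0 < Nat.card S := Nat.card_pos
  have hBn : #B = ∑ i ∈ B.image Prod.fst, #(B.filter fun z => z.1 = i) := card_eq_sum_card_image _ _
  have hsub : B.image Prod.fst ⊆ Icc 0 L := by
    intro i hi
    obtain ⟨z, hz, rfl⟩ := mem_image.1 hi
    exact mem_Icc.2 (hr z hz)
  have hL0 : 0 ≤ L := by
    obtain ⟨i, hi⟩ := card_pos.1 (show 0 < #(B.image Prod.fst) by omega)
    have := mem_Icc.1 (hsub hi)
    omega
  have hcardle := card_le_card hsub
  lift L to ℕ using hL0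
  rw [Int.card_Icc] at hcardle
  have hlt : 3 * #B ≤ #(B.image Prod.fst) * (2 * Nat.card S) := by
    rw [hBn, mul_sum]
    exact sum_le_card_nsmul _ _ _ fun i hi => (hcon i hi).le
  have hcard' : L * Nat.card S + #B ≤ #(B + B) := by exact_mod_cast hcard
  -- `L|S| ≤ |B + B| - |B| < 3/2 |B|`, at most `|S|` times the number of levels; hence no level of
  -- `[0, L]` is missing.
  have hLs : L < #(B.image Prod.fst) := by
    refine lt_of_mul_lt_mul_right (a := 2 * Nat.card S) ?_ (Nat.zero_le _)
    nlinarith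
  have hA : B.image Prod.fst = Icc 0 (L : ℤ) :=
    eq_of_subset_of_card_le hsub (by rw [Int.card_Icc]; omega)
  have hne : ∀ i : ℕ, i ≤ L → ∃ z ∈ B, z.1 = i := by
    intro i hi
    have : (i : ℤ) ∈ B.image Prod.fst := by rw [hA, mem_Icc]; omega
    simpa using this
  have hconv : ∀ (g : ℤ → ℕ) (n : ℕ), ∑ i ∈ Icc 0 (n : ℤ), g i = ∑ i ∈ range (n + 1), g i := by
    intro g n
    symm
    refine sum_nbij (fun i : ℕ => (i : ℤ)) (fun i hi => ?_) (fun i _ j _ hij => by simpa using hij)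
      (fun i hi => ?_) fun _ _ => rfl
    · rw [mem_range] at hi
      rw [mem_Icc]
      omega
    · rw [mem_coe, mem_Icc] at hi
      exact ⟨i.toNat, by simp only [coe_range, Set.mem_Iio]; omega, by simp only; omega⟩
  have hsubset : ∀ i j : ℕ, (B.filter fun z => z.1 = (i : ℤ)) + (B.filter fun z => z.1 = (j : ℤ))
      ⊆ (B + B).filter fun z => z.1 = ((i + j : ℕ) : ℤ) := by
    intro i j z hz
    obtain ⟨u, hu, v, hv, rfl⟩ := mem_add.1 hz
    obtain ⟨hu, hui⟩ := mem_filter.1 hu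
    obtain ⟨hv, hvj⟩ := mem_filter.1 hv
    exact mem_filter.2 ⟨add_mem_add hu hv, by simp [hui, hvj]⟩
  rw [hA, hconv (fun i => #(B.filter fun z => z.1 = i))] at hBn
  have hBB : ∑ j ∈ range (2 * L + 1), #((B + B).filter fun z => z.1 = (j : ℤ)) = #(B + B) := by
    rw [← hconv (fun j => #((B + B).filter fun z => z.1 = j)),
      sum_card_fiberwise_eq_card_filter, filter_true_of_mem]
    intro z hz
    obtain ⟨u, hu, v, hv, rfl⟩ := mem_add.1 hz
    have := hr u hu
    have := hr v hv
    rw [mem_Icc, Prod.fst_add]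
    push_cast
    omega
  refine small_fibers_false (f := fun i => #(B.filter fun z => z.1 = (i : ℤ)))
    (F := fun j => #((B + B).filter fun z => z.1 = (j : ℤ))) (h := Nat.card S) (l := L)
    (by omega) (fun i hi => hcon i ?_) (fun i hi j hj => ?_) (fun i hi j hj hij => ?_) ?_ ?_
  · rw [hA, mem_Icc]
    omega
  · obtain ⟨w, hw, hwj⟩ := hne j hj
    have hw' : (B.filter fun z => z.1 = (j : ℤ)).Nonempty := ⟨w, mem_filter.2 ⟨hw, hwj⟩⟩
    have hle := card_le_card_add_right (s := B.filter fun z => z.1 = (i : ℤ)) hw'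
    exact hle.trans (card_le_card (hsubset i j))
  · have hle := card_le_card (hsubset i j)
    refine le_trans ?_ hle
    obtain ⟨u, hu, hui⟩ := hne i hi
    obtain ⟨v, hv, hvj⟩ := hne j hj
    have key : ∀ z ∈ B, ∀ w ∈ B, z.1 = w.1 → z - w ∈ S := by
      intro z hz w hw hzw
      have : AddMonoidHom.inr ℤ G (z.2 - w.2) = z - w := by ext <;> simp [hzw]
      refine ⟨z.2 - w.2, ?_, this⟩
      change AddMonoidHom.inr ℤ G (z.2 - w.2) ∈ K
      rw [this]
      exact sub_mem (hK z hz) (hK w hw)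
    refine card_le_card_add_of_lt u v (fun z hz => ?_) (fun z hz => ?_) hij
    · exact key z (mem_filter.1 hz).1 u hu ((mem_filter.1 hz).2.trans hui.symm)
    · exact key z (mem_filter.1 hz).1 v hv ((mem_filter.1 hz).2.trans hvj.symm)
  · rw [hBB, ← hBn]
    exact hcard'
  · rw [hBB, ← hBn]
    exact hdbl

end LargeFiber

/-! ### Translation to the given set and conclusion. -/

section Main

open Finset

lemma mem_fiberUnion {s d : ℕ} {a : Fin s → ℤ} {B : Fin s → Finset (ZMod d)} {z : ℤ × ZMod d} :
    z ∈ fiberUnion a B ↔ ∃ i, z.1 = a i ∧ z.2 ∈ B i := by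
  simp only [fiberUnion, mem_biUnion, mem_univ, true_and, mem_product, mem_singleton]

/-- The projection of `K` to `ℤ` is cyclic, and its generator divides every `a i`. -/
lemma exists_one_mem_of_gcd_eq_one {s : ℕ} {G : Type*} [AddCommGroup G] {a : Fin s → ℤ}
    {K : AddSubgroup (ℤ × G)} (hgcd : (univ.filter fun i => a i ≠ 0).gcd a = 1)
    (ha : ∀ i, ∃ x, ((a i, x) : ℤ × G) ∈ K) : ∃ x, ((1, x) : ℤ × G) ∈ K := by
  obtain ⟨g, hg⟩ := Int.subgroup_cyclic (K.map (AddMonoidHom.fst ℤ G))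
  have hdvd : g ∣ (univ.filter fun i => a i ≠ 0).gcd a := by
    refine dvd_gcd fun i _ => ?_
    obtain ⟨x, hx⟩ := ha i
    have : a i ∈ K.map (AddMonoidHom.fst ℤ G) := ⟨_, hx, rfl⟩
    rw [hg, AddSubgroup.mem_closure_singleton] at this
    obtain ⟨n, hn⟩ := this
    exact ⟨n, by rw [← hn, smul_eq_mul, mul_comm]⟩
  rw [hgcd] at hdvd
  obtain ⟨c, hc⟩ := hdvd
  have : (1 : ℤ) ∈ K.map (AddMonoidHom.fst ℤ G) := by
    rw [hg, AddSubgroup.mem_closure_singleton]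
    exact ⟨c, by rw [smul_eq_mul, mul_comm, ← hc]⟩
  obtain ⟨⟨i, x⟩, hx, rfl⟩ := this
  exact ⟨x, hx⟩

end Main

theorem theorem5 (s d : ℕ) (hs : 6 ≤ s) (hd : 0 < d)
    (a : Fin s → ℤ) (ha : Function.Injective a) (ha₁ : a ⟨0, by omega⟩ = 0)
    (hgcd : (Finset.univ.filter fun i => a i ≠ 0).gcd a = 1)
    (B : Fin s → Finset (ZMod d)) (hB : ∀ i, (B i).Nonempty)
    (hB₁ : (0 : ZMod d) ∈ B ⟨0, by omega⟩)
    (hdoubling : ((fiberUnion a B + fiberUnion a B).card : ℝ)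
      < 5 / 2 * ((fiberUnion a B).card : ℝ))
    (M : ℤ) (hM : IsGreatest (Set.range a) M) :
    (M : ℝ) < 3 / 2 * (s : ℝ) ∧
    ∃ H : AddSubgroup (ZMod d),
      (∃ x y : ZMod d, ∀ i, (B i : Set (ZMod d)) ⊆ (a i • x + y) +ᵥ (H : Set (ZMod d))) ∧
      (∃ j, 2 / 3 * (Nat.card H : ℝ) ≤ ((B j).card : ℝ)) ∧
      M * (Nat.card H : ℤ)
        ≤ ((fiberUnion a B + fiberUnion a B).card : ℤ) - ((fiberUnion a B).card : ℤ) := by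
  have : NeZero d := ⟨hd.ne'⟩
  obtain ⟨⟨jM, rfl⟩, hmax⟩ := hM
  have hmax : ∀ i, a i ≤ a jM := fun i => hmax ⟨i, rfl⟩
  obtain ⟨j₀, -, hmin⟩ := Finset.exists_min_image Finset.univ a ⟨⟨0, by omega⟩, Finset.mem_univ _⟩
  have hmin : ∀ i, a j₀ ≤ a i := fun i => hmin i (Finset.mem_univ _)
  obtain ⟨y₀, hy₀⟩ := hB j₀
  obtain ⟨yM, hyM⟩ := hB jM
  set U := fiberUnion a B with hU
  -- translate so that the lowest fibre lies over zero and contains zero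
  set V := {-((a j₀, y₀) : ℤ × ZMod d)} + U with hV
  have hcV : V.card = U.card := Finset.card_singleton_add _ _
  have hcVV : (V + V).card = (U + U).card := by
    rw [hV, add_add_add_comm, Finset.singleton_add_singleton]
    exact Finset.card_singleton_add _ _
  have hmemV : ∀ z, z ∈ V ↔ z + (a j₀, y₀) ∈ U := by
    intro z
    rw [hV, Finset.mem_add]
    simp only [Finset.mem_singleton, exists_eq_left]
    constructor
    · rintro ⟨c, hc, rfl⟩
      rwa [neg_add_eq_sub, sub_add_cancel]
    · intro hz
      exact ⟨_, hz, by rw [neg_add_eq_sub, add_sub_cancel_right]⟩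
  have hdbl : 2 * (U + U).card < 5 * U.card := by
    have : 2 * ((U + U).card : ℝ) < 5 * U.card := by linarith
    exact_mod_cast this
  have h0 : (0 : ℤ × ZMod d) ∈ V := by
    rw [hmemV, zero_add, hU, mem_fiberUnion]
    exact ⟨j₀, rfl, hy₀⟩
  have hg : ((a jM - a j₀, yM - y₀) : ℤ × ZMod d) ∈ V := by
    rw [hmemV, hU, mem_fiberUnion]
    exact ⟨jM, by simp, by simpa using hyM⟩
  have hr : ∀ z ∈ V, 0 ≤ z.1 ∧ z.1 ≤ a jM - a j₀ := by
    intro z hz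
    rw [hmemV, hU, mem_fiberUnion] at hz
    obtain ⟨i, hi, -⟩ := hz
    have := hmin i
    have := hmax i
    rw [Prod.fst_add] at hi
    simp only at hi
    omega
  have himage : V.image Prod.fst = Finset.univ.image fun i => a i - a j₀ := by
    ext c
    simp only [Finset.mem_image, Finset.mem_univ, true_and]
    constructor
    · rintro ⟨z, hz, rfl⟩
      rw [hmemV, hU, mem_fiberUnion] at hz
      obtain ⟨i, hi, -⟩ := hz
      exact ⟨i, by rw [← hi]; simp⟩
    · rintro ⟨i, rfl⟩
      obtain ⟨w, hw⟩ := hB i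
      refine ⟨(a i - a j₀, w - y₀), ?_, rfl⟩
      rw [hmemV, hU, mem_fiberUnion]
      exact ⟨i, by simp, by simpa using hw⟩
  have hs' : 6 ≤ (V.image Prod.fst).card := by
    rw [himage, Finset.card_image_of_injective _ fun i j hij => ha (by simpa using hij)]
    simpa using hs
  have hL : 0 < a jM - a j₀ := by
    have h1 : a ⟨0, by omega⟩ ≠ a ⟨1, by omega⟩ := fun h => by simpa using ha h
    have := hmin ⟨0, by omega⟩
    have := hmin ⟨1, by omega⟩
    have := hmax ⟨0, by omega⟩
    have := hmax ⟨1, by omega⟩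
    omega
  obtain ⟨K, hVK, hK⟩ := exists_addSubgroup_of_small_doubling hL h0 hg hr hs' (by rwa [hcV, hcVV])
  have hUK : ∀ i, ∀ w ∈ B i, ((a i - a j₀, w - y₀) : ℤ × ZMod d) ∈ K := by
    intro i w hw
    refine hVK _ ?_
    rw [hmemV, hU, mem_fiberUnion]
    exact ⟨i, by simp, by simpa using hw⟩
  obtain ⟨x, hx⟩ := exists_one_mem_of_gcd_eq_one hgcd (K := K) fun i => by
    obtain ⟨w, hw⟩ := hB i
    refine ⟨w - 0, ?_⟩
    -- Subtracting the translate of `(0, 0)` undoes the translation, so `K` contains points over the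
    -- original `a i`.
    have := K.sub_mem (hUK i w hw) (hUK _ 0 hB₁)
    rw [ha₁] at this
    simpa using this
  have hLH := hK x hx
  obtain ⟨c, hc, hc'⟩ := exists_two_mul_card_le_three_mul_card_fiber hr hs' (by rwa [hcV, hcVV])
    hVK hLH
  set H := K.comap (AddMonoidHom.inr ℤ (ZMod d)) with hH
  rw [hcV, hcVV] at hLH
  have hcoset : ∀ i, ∀ w ∈ B i, w - (a i • x + (y₀ - a j₀ • x)) ∈ H := by
    intro i w hw
    have h1 := K.sub_mem (hUK i w hw) (K.zsmul_mem hx (a i - a j₀))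
    have h2 : ((a i - a j₀, w - y₀) : ℤ × ZMod d) - (a i - a j₀) • (1, x)
        = AddMonoidHom.inr ℤ (ZMod d) (w - (a i • x + (y₀ - a j₀ • x))) := by
      ext
      · simp
      · simp only [Prod.snd_sub, Prod.smul_snd, AddMonoidHom.inr_apply, sub_smul]
        abel
    rw [h2] at h1
    exact h1
  have hpos : 0 < Nat.card H := Nat.card_pos
  -- The lowest level is at most `0`, because `0` is one of the levels.
  have hM0 : a jM ≤ a jM - a j₀ := by
    have := hmin ⟨0, by omega⟩
    omega
  have hMH : a jM * (Nat.card H : ℤ) + U.card ≤ (U + U).card := by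
    have := mul_le_mul_of_nonneg_right hM0 (Int.natCast_nonneg (Nat.card H))
    omega
  have hUs : U.card ≤ s * Nat.card H := by
    rw [hU, fiberUnion]
    refine Finset.card_biUnion_le.trans ((Finset.sum_le_card_nsmul _ _ (Nat.card H)
      fun i _ => ?_).trans (by simp))
    rw [Finset.card_product, Finset.card_singleton, one_mul]
    exact card_le_card_of_sub_mem _ (hcoset i)
  refine ⟨?_, H, ⟨x, y₀ - a j₀ • x, fun i w hw => ?_⟩, ?_, by omega⟩
  · have h1 : (2 * a jM) * (Nat.card H : ℤ) < (3 * s) * (Nat.card H : ℤ) := by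
      zify at hUs hdbl
      linarith
    have h2 : 2 * a jM < 3 * s := lt_of_mul_lt_mul_right h1 (Int.natCast_nonneg _)
    have h3 : 2 * (a jM : ℝ) < 3 * s := by exact_mod_cast h2
    linarith
  · exact Set.mem_vadd_set.2 ⟨_, hcoset i w hw, by simp⟩
  · rw [himage] at hc
    obtain ⟨j, -, rfl⟩ := Finset.mem_image.1 hc
    refine ⟨j, ?_⟩
    have h1 : (V.filter fun z => z.1 = a j - a j₀).card ≤ (B j).card := by
      refine Finset.card_le_card_of_injOn (fun z => z.2 + y₀) (fun z hz => ?_)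
        fun u hu v hv huv => ?_
      · obtain ⟨hz, hzj⟩ := Finset.mem_filter.1 hz
        rw [hmemV, hU, mem_fiberUnion] at hz
        obtain ⟨i, hi, hi'⟩ := hz
        have : i = j := ha (by rw [← hi, Prod.fst_add, hzj]; simp)
        rw [← this]
        exact hi'
      · exact Prod.ext ((Finset.mem_filter.1 hu).2.trans (Finset.mem_filter.1 hv).2.symm)
          (by simpa using huv)
    have h2 : 2 * Nat.card H ≤ 3 * (B j).card := by omega
    have h3 : 2 * (Nat.card H : ℝ) ≤ 3 * (B j).card := by exact_mod_cast h2
    linarith
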